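/- **Theorem 1.** A Bayesian contextual bandit problem $\Phi$ over $T$ rounds consists of a prior $P_\Theta$ on a (standard Borel) parameter space $\mathcal O$, a context distribution $P_X$ on $\mathcal X$ and a reward kernel $\kappa$ from $\mathcal X\times\mathcal A\times\mathcal O$ to $\mathbb R$; we write $R(x,a,\theta)$ for a reward drawn from $\kappa(\cdot,(x,a,\theta))$. Its optimal cumulative reward is $R^\star_\Phi=\sup_\psi E\big[\sum_{t=1}^T R(X_t,\psi(X_t,\Theta),\Theta)\big]$, the supremum being over measurable decision rules $\psi:\mathcal X\times\mathcal O\to\mathcal A$ for which the expectation is defined and finite, where $\Theta\sim P_\Theta$ and $X_t\sim P_X$ are independent. Assume that a decision rule $\psi^\star$ attains this supremum. Thompson sampling starts from the empty history $\hat H^1$; in each round $t=1,\dots,T$ it observes a context $X_t\sim P_X$ independent of $(\Theta,\hat H^t)$, samples $\hat\Theta_t$ from the posterior $P_{\Theta\mid\hat H^t}$ (conditionally independently of $(X_t,\Theta)$ given $\hat H^t$), plays $\hat A_t=\psi^\star(X_t,\hat\Theta_t)$, collects $R_t=R(X_t,\hat A_t,\Theta)$, which given $(\hat H^t,X_t,\hat\Theta_t,\Theta)$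 has law $\kappa(\cdot,(X_t,\hat A_t,\Theta))$, and sets $\hat H^{t+1}=(\hat H^t,(\hat A_t,X_t,R_t))$. Assume that each $R_t$ is integrable. Let $R^\star_t=R(X_t,\psi^\star(X_t,\Theta),\Theta)$ be the reward of optimal play, which given $(\hat H^t,X_t,\Theta)$ has law $\kappa(\cdot,(X_t,\psi^\star(X_t,\Theta),\Theta))$. The Thompson sampling cumulative regret is $\mathrm{REG}^{\mathrm{TS}}_\Phi=R^\star_\Phi-E\big[\sum_{t=1}^T R_t\big]$. Write $E_t[\cdot]=E[\cdot\mid\hat H^t,X_t]$, $I_t(\Theta;R_t\mid\hat A_t)=E_t\big[\mathrm{KL}(P_{R_t\mid\hat H^t,X_t,\hat A_t,\Theta}\,\|\,P_{R_t\mid\hat H^t,X_t,\hat A_t})\big]$, and let the lifted information ratio be $$\Gamma_t=\frac{\big(E_t[R^\star_t-R_t]\big)^2}{I_t(\Theta;R_t\mid\hat A_t)}\in[0,\infty],$$ with $0/0=0$, $c/0=\infty$ for $c>0$, and $c/\infty=0$ for $c\ge 0$. Suppose that $\frac1T\sum_{t=1}^T E[\Gamma_t]\le\Gamma$ for some real $\Gamma>0$.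 Then, with $I(\Theta;\hat H^{T+1})=\mathrm{KL}(P_{\Theta,\hat H^{T+1}}\,\|\,P_\Theta\otimes P_{\hat H^{T+1}})\in[0,\infty]$ the mutual information, $$\mathrm{REG}^{\mathrm{TS}}_\Phi\;\le\;\sqrt{\Gamma\,T\,I(\Theta;\hat H^{T+1})},\qquad I(\Theta;\hat H^{T+1})=E\big[\mathrm{KL}(P_{\Theta\mid\hat H^{T+1}}\,\|\,P_\Theta)\big].$$ -/

import Mathlib

open MeasureTheory ProbabilityTheory InformationTheory
open scoped ENNReal

noncomputable section

/-- The mutual information `I(U; V) = KL(P_{U,V} ‖ P_U ⊗ P_V)` of two random variables. -/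
def mutualInformation {Ω 𝓤 𝓥 : Type*} [MeasurableSpace Ω] [MeasurableSpace 𝓤] [MeasurableSpace 𝓥]
    (U : Ω → 𝓤) (V : Ω → 𝓥) (P : Measure Ω) : ℝ≥0∞ :=
  klDiv (P.map fun ω => (U ω, V ω)) ((P.map U).prod (P.map V))

/-- A Bayesian contextual bandit problem: a prior on the environment parameters `𝒪`, a
distribution on the contexts `𝒳`, and a reward kernel from (context, action, parameter) to `ℝ`. -/
structure ContextualBandit (𝒳 𝒜 𝒪 : Type*) [MeasurableSpace 𝒳] [MeasurableSpace 𝒜]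
    [MeasurableSpace 𝒪] where
  prior : Measure 𝒪
  context : Measure 𝒳
  reward : Kernel (𝒳 × 𝒜 × 𝒪) ℝ
  isProbabilityMeasure_prior : IsProbabilityMeasure prior
  isProbabilityMeasure_context : IsProbabilityMeasure context
  isMarkovKernel_reward : IsMarkovKernel reward

namespace ContextualBandit

variable {𝒳 𝒜 𝒪 Ω : Type*} [MeasurableSpace 𝒳] [MeasurableSpace 𝒜] [MeasurableSpace 𝒪]
  [MeasurableSpace Ω]

/-! ### The optimal cumulative reward -/

/-- The law of the reward `R(X, ψ(X, Θ), Θ)` of one round played with the decision rule `ψ`, for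
a context `X` and a parameter `Θ` that are independent with laws `Φ.context` and `Φ.prior`. -/
def ruleRewardLaw (Φ : ContextualBandit 𝒳 𝒜 𝒪) (ψ : 𝒳 × 𝒪 → 𝒜) : Measure ℝ :=
  ((Φ.context.prod Φ.prior).map fun p => (p.1, ψ p, p.2)).bind Φ.reward

/-- The decision rules whose expected reward is defined. -/
def IsAdmissibleRule (Φ : ContextualBandit 𝒳 𝒜 𝒪) (ψ : 𝒳 × 𝒪 → 𝒜) : Prop :=
  Measurable ψ ∧ Integrable (fun r : ℝ => r) (Φ.ruleRewardLaw ψ)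

/-- The expected cumulative reward `E[∑_{t ≤ T} R(X_t, ψ(X_t, Θ), Θ)]` of a decision rule. -/
def ruleReward (Φ : ContextualBandit 𝒳 𝒜 𝒪) (T : ℕ) (ψ : 𝒳 × 𝒪 → 𝒜) : ℝ :=
  ∑ _t ∈ Finset.range T, ∫ r, r ∂(Φ.ruleRewardLaw ψ)

/-- The optimal cumulative reward: the supremum of the expected cumulative rewards of the
admissible decision rules. -/
def optimalReward (Φ : ContextualBandit 𝒳 𝒜 𝒪) (T : ℕ) : ℝ :=
  sSup {c | ∃ ψ, Φ.IsAdmissibleRule ψ ∧ c = Φ.ruleReward T ψ}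

/-- `ψ` is an optimal decision rule: it attains the supremum above. -/
def IsOptimalRule (Φ : ContextualBandit 𝒳 𝒜 𝒪) (T : ℕ) (ψ : 𝒳 × 𝒪 → 𝒜) : Prop :=
  Φ.IsAdmissibleRule ψ ∧ ∀ ψ', Φ.IsAdmissibleRule ψ' → Φ.ruleReward T ψ' ≤ Φ.ruleReward T ψ

/-! ### Thompson sampling

Rounds are numbered from `0`: the index `t` stands for round `t + 1`. -/

/-- The action `Â_t = ψ(X_t, Θ̂_t)`. -/
def tsAction (ψ : 𝒳 × 𝒪 → 𝒜) (X : ℕ → Ω → 𝒳) (Θhat : ℕ → Ω → 𝒪) (t : ℕ) (ω : Ω) : 𝒜 :=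
  ψ (X t ω, Θhat t ω)

/-- The history collected in the rounds with index less than `t` (so `tsHistory ψ X Θhat R T` is
the history after all `T` rounds). -/
def tsHistory (ψ : 𝒳 × 𝒪 → 𝒜) (X : ℕ → Ω → 𝒳) (Θhat : ℕ → Ω → 𝒪) (R : ℕ → Ω → ℝ)
    (t : ℕ) (ω : Ω) : Fin t → 𝒜 × 𝒳 × ℝ :=
  fun s => (tsAction ψ X Θhat s ω, X s ω, R s ω)

/-- The random variables `Θ` (true parameter), `X t` (contexts), `Θhat t` (parameters sampled by
the algorithm), `R t` (rewards collected by the algorithm) and `Rstar t` (rewards collected by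
playing optimally), for `t < T`, are a run of Thompson sampling with decision rule `ψ` on the
bandit problem `Φ` over `T` rounds. -/
structure IsThompsonSampling [StandardBorelSpace 𝒪] [Nonempty 𝒪] (Φ : ContextualBandit 𝒳 𝒜 𝒪)
    (T : ℕ) (ψ : 𝒳 × 𝒪 → 𝒜) (P : Measure Ω) [IsProbabilityMeasure P] (Θ : Ω → 𝒪)
    (X : ℕ → Ω → 𝒳) (Θhat : ℕ → Ω → 𝒪) (R Rstar : ℕ → Ω → ℝ) : Prop where
  measurable_param : Measurable Θ
  measurable_context : ∀ t < T, Measurable (X t)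
  measurable_sample : ∀ t < T, Measurable (Θhat t)
  measurable_reward : ∀ t < T, Measurable (R t)
  measurable_rewardStar : ∀ t < T, Measurable (Rstar t)
  /-- `Θ` is distributed according to the prior. -/
  map_param : P.map Θ = Φ.prior
  /-- `X_t` is distributed according to the context distribution -/
  map_context : ∀ t < T, P.map (X t) = Φ.context
  /-- and is independent of the parameter and of the history. -/
  indepFun_context : ∀ t < T,
    IndepFun (X t) (fun ω => (Θ ω, tsHistory ψ X Θhat R t ω)) P
  /-- Given the history, the context (and `Θ`), the parameter `Θ̂_t` is drawn from the posterior
  `P_{Θ | Ĥ^t}`. -/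
  sample : ∀ t < T, ∀ᵐ ω ∂P,
    condDistrib (Θhat t) (fun ω' => (tsHistory ψ X Θhat R t ω', X t ω', Θ ω')) P
        (tsHistory ψ X Θhat R t ω, X t ω, Θ ω)
      = condDistrib Θ (tsHistory ψ X Θhat R t) P (tsHistory ψ X Θhat R t ω)
  /-- The reward `R_t = R(X_t, Â_t, Θ)` is drawn from the reward kernel. -/
  reward : ∀ t < T, ∀ᵐ ω ∂P,
    condDistrib (R t) (fun ω' => (tsHistory ψ X Θhat R t ω', X t ω', Θhat t ω', Θ ω')) P
        (tsHistory ψ X Θhat R t ω, X t ω, Θhat t ω, Θ ω)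
      = Φ.reward (X t ω, tsAction ψ X Θhat t ω, Θ ω)
  /-- The reward `R⋆_t = R(X_t, ψ(X_t, Θ), Θ)` is drawn from the reward kernel. -/
  rewardStar : ∀ t < T, ∀ᵐ ω ∂P,
    condDistrib (Rstar t) (fun ω' => (tsHistory ψ X Θhat R t ω', X t ω', Θ ω')) P
        (tsHistory ψ X Θhat R t ω, X t ω, Θ ω)
      = Φ.reward (X t ω, ψ (X t ω, Θ ω), Θ ω)
  /-- The expected rewards of the algorithm are defined. -/
  integrable_reward : ∀ t < T, Integrable (R t) P

/-- The Bayesian expected regret: the optimal cumulative reward minus the expected cumulative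
reward `E[∑_{t ≤ T} R_t]` that is collected. -/
def regret (Φ : ContextualBandit 𝒳 𝒜 𝒪) (T : ℕ) (P : Measure Ω) (R : ℕ → Ω → ℝ) : ℝ :=
  Φ.optimalReward T - ∫ ω, ∑ t ∈ Finset.range T, R t ω ∂P

/-! ### The lifted information ratio -/

/-- The σ-algebra generated by `(Ĥ^t, X_t)`; `E_t` is the conditional expectation given it. -/
abbrev roundSigma (ψ : 𝒳 × 𝒪 → 𝒜) (X : ℕ → Ω → 𝒳) (Θhat : ℕ → Ω → 𝒪) (R : ℕ → Ω → ℝ) (t : ℕ) :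
    MeasurableSpace Ω :=
  MeasurableSpace.comap (fun ω => (tsHistory ψ X Θhat R t ω, X t ω)) inferInstance

/-- The disintegrated conditional mutual information
`I_t(Θ; R_t | Â_t) = E_t[KL(P_{R_t | Ĥ^t, X_t, Â_t, Θ} ‖ P_{R_t | Ĥ^t, X_t, Â_t})]`. -/
def disintegratedInformation (ψ : 𝒳 × 𝒪 → 𝒜) (P : Measure Ω) [IsProbabilityMeasure P]
    (Θ : Ω → 𝒪) (X : ℕ → Ω → 𝒳) (Θhat : ℕ → Ω → 𝒪) (R : ℕ → Ω → ℝ) (t : ℕ) : Ω → ℝ≥0∞ :=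
  condLExp (roundSigma ψ X Θhat R t) P fun ω =>
    klDiv
      (condDistrib (R t)
        (fun ω' => (tsHistory ψ X Θhat R t ω', X t ω', tsAction ψ X Θhat t ω', Θ ω')) P
        (tsHistory ψ X Θhat R t ω, X t ω, tsAction ψ X Θhat t ω, Θ ω))
      (condDistrib (R t)
        (fun ω' => (tsHistory ψ X Θhat R t ω', X t ω', tsAction ψ X Θhat t ω')) P
        (tsHistory ψ X Θhat R t ω, X t ω, tsAction ψ X Θhat t ω))

/-- The lifted information ratio `Γ_t = E_t[R⋆_t - R_t]² / I_t(Θ; R_t | Â_t)`, with values in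
`[0, ∞]`; here `0 / 0 = 0` and `c / 0 = ∞` for `c > 0`. -/
def liftedInformationRatio (ψ : 𝒳 × 𝒪 → 𝒜) (P : Measure Ω) [IsProbabilityMeasure P]
    (Θ : Ω → 𝒪) (X : ℕ → Ω → 𝒳) (Θhat : ℕ → Ω → 𝒪) (R Rstar : ℕ → Ω → ℝ) (t : ℕ) (ω : Ω) :
    ℝ≥0∞ :=
  ENNReal.ofReal ((condExp (roundSigma ψ X Θhat R t) P (fun ω' => Rstar t ω' - R t ω') ω) ^ 2)
    / disintegratedInformation ψ P Θ X Θhat R t ω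

end ContextualBandit

end

/-! Let `D_t = E_t[R⋆_t - R_t]`. Optimal play in each round has the reward law of `ψ`, so by the
tower property the regret is `∑ E[D_t]` (`regret_eq_sum_integral_condExp`). The definition of the
ratio gives `|D_t| = √(Γ_t I_t)` wherever both factors are finite. Cauchy-Schwarz on `Ω` and then
over the rounds yields `REG ≤ √(∑ E[Γ_t] · ∑ E[I_t])`, whose first sum is at most `ΓT`.

The second sum is at most the information that the final history carries on `Θ`: by the chain rule
for the divergence, each round adds at least `E[I_t]` (`mutualInformation_add_lintegral_klDiv_le`,
summed in `sum_lintegral_disintegratedInformation_le`). The chain rule and the posterior formula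
both rest on `klDiv_compProd_right_eq_lintegral`. -/

/-! ### Kullback-Leibler divergence between kernels -/

namespace InformationTheory

variable {α β : Type*} {mα : MeasurableSpace α} {mβ : MeasurableSpace β}
  [MeasurableSpace.CountableOrCountablyGenerated α β]

-- The kernel density `κ.rnDeriv η` is jointly measurable, unlike densities chosen separately for
-- each `a`; this form makes the divergence measurable in `a`.
open scoped Classical in
lemma klDiv_kernel_apply (κ η : Kernel α β) [IsMarkovKernel κ] [IsMarkovKernel η] (a : α) :
    klDiv (κ a) (η a) = if κ a ≪ η a then
      ∫⁻ x, ENNReal.ofReal (klFun (κ.rnDeriv η a x).toReal) ∂(η a) else ∞ := by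
  rw [klDiv_eq_lintegral_klFun]
  split_ifs with h
  · refine lintegral_congr_ae ?_
    filter_upwards [κ.rnDeriv_eq_rnDeriv_measure (η := η) (a := a)] with x hx
    rw [hx]
  · rfl

lemma measurable_klDiv_kernel (κ η : Kernel α β) [IsMarkovKernel κ] [IsMarkovKernel η] :
    Measurable fun a => klDiv (κ a) (η a) := by
  classical
  simp_rw [klDiv_kernel_apply]
  refine Measurable.ite (Kernel.measurableSet_absolutelyContinuous κ η) ?_ measurable_const
  refine Measurable.lintegral_kernel_prod_right
    (f := fun a x => ENNReal.ofReal (klFun (κ.rnDeriv η a x).toReal)) ?_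
  have := κ.measurable_rnDeriv η
  simp only [Function.uncurry_def]
  fun_prop

/-- The divergence of two composition-products with the same first marginal is the average of the
divergences of the kernels. -/
lemma klDiv_compProd_right_eq_lintegral (μ : Measure α) [IsFiniteMeasure μ] (κ η : Kernel α β)
    [IsMarkovKernel κ] [IsMarkovKernel η] :
    klDiv (μ ⊗ₘ κ) (μ ⊗ₘ η) = ∫⁻ a, klDiv (κ a) (η a) ∂μ := by
  classical
  by_cases h : ∀ᵐ a ∂μ, κ a ≪ η a
  · have hac : μ ⊗ₘ κ ≪ μ ⊗ₘ η := Measure.absolutelyContinuous_compProd_right_iff.mpr h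
    have hmeas := κ.measurable_rnDeriv η
    have hcomp : μ ⊗ₘ κ = (μ ⊗ₘ η).withDensity fun p => κ.rnDeriv η p.1 p.2 := by
      rw [← Measure.compProd_withDensity (f := κ.rnDeriv η) hmeas]
      refine Measure.compProd_congr ?_
      filter_upwards [h] with a ha
      exact (Kernel.withDensity_rnDeriv_eq ha).symm
    have hrn : (μ ⊗ₘ κ).rnDeriv (μ ⊗ₘ η) =ᵐ[μ ⊗ₘ η] fun p => κ.rnDeriv η p.1 p.2 := by
      rw [hcomp]
      exact Measure.rnDeriv_withDensity _ hmeas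
    rw [klDiv_eq_lintegral_klFun_of_ac hac]
    calc ∫⁻ p, ENNReal.ofReal (klFun ((μ ⊗ₘ κ).rnDeriv (μ ⊗ₘ η) p).toReal) ∂(μ ⊗ₘ η)
        = ∫⁻ p, ENNReal.ofReal (klFun (κ.rnDeriv η p.1 p.2).toReal) ∂(μ ⊗ₘ η) := by
          refine lintegral_congr_ae ?_
          filter_upwards [hrn] with p hp
          rw [hp]
      _ = ∫⁻ a, ∫⁻ x, ENNReal.ofReal (klFun (κ.rnDeriv η a x).toReal) ∂(η a) ∂μ := by
          rw [Measure.lintegral_compProd (by fun_prop)]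
      _ = ∫⁻ a, klDiv (κ a) (η a) ∂μ := by
          refine lintegral_congr_ae ?_
          filter_upwards [h] with a ha
          rw [klDiv_kernel_apply, if_pos ha]
  -- Both sides are infinite: a finite average would make almost every `klDiv (κ a) (η a)` finite,
  -- hence `κ a ≪ η a` almost everywhere.
  · rw [klDiv_of_not_ac (fun hac => h (Measure.absolutelyContinuous_compProd_right_iff.mp hac))]
    by_contra hne
    refine h ?_
    filter_upwards [ae_lt_top (measurable_klDiv_kernel κ η) (Ne.symm hne)] with a ha
    by_contra hna
    simp [klDiv_of_not_ac hna] at ha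

end InformationTheory

/-! ### Mutual information -/

section MutualInformation

variable {Ω 𝓤 𝓥 𝓦 𝓢 : Type*} [MeasurableSpace Ω] [MeasurableSpace 𝓤] [MeasurableSpace 𝓥]
  [MeasurableSpace 𝓦] [MeasurableSpace 𝓢] {P : Measure Ω} [IsProbabilityMeasure P]

/-- Data processing: `id × f` sends the joint law and the product of the marginals to their
counterparts for `f ∘ V`. -/
lemma mutualInformation_comp_right_le {U : Ω → 𝓤} {V : Ω → 𝓥} (hU : Measurable U)
    (hV : Measurable V) {f : 𝓥 → 𝓦} (hf : Measurable f) :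
    mutualInformation U (fun ω => f (V ω)) P ≤ mutualInformation U V P := by
  have h := klDiv_map_le (P.map fun ω => (U ω, V ω)) ((P.map U).prod (P.map V))
    (g := Prod.map id f) (measurable_id.prodMap hf)
  rw [Measure.map_map (measurable_id.prodMap hf) (hU.prodMk hV),
    ← Measure.map_prod_map _ _ measurable_id hf, Measure.map_id, Measure.map_map hf hV] at h
  exact h

/-- Mutual information is the average divergence from the prior to the posterior. -/
lemma mutualInformation_eq_lintegral_klDiv_condDistrib [StandardBorelSpace 𝓤] [Nonempty 𝓤]
    {U : Ω → 𝓤} {V : Ω → 𝓥} (hU : Measurable U) (hV : Measurable V) :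
    mutualInformation U V P = ∫⁻ ω, klDiv (condDistrib U V P (V ω)) (P.map U) ∂P := by
  have := Measure.isProbabilityMeasure_map (μ := P) hU.aemeasurable
  -- A composition-product needs the conditioning variable first. The swap is an involution, so data
  -- processing in both directions gives equality.
  have hswap : mutualInformation U V P
      = klDiv (P.map fun ω => (V ω, U ω)) ((P.map V).prod (P.map U)) := by
    refine le_antisymm ?_ ?_
    · have h := klDiv_map_le (P.map fun ω => (V ω, U ω)) ((P.map V).prod (P.map U)) measurable_swap
      rw [Measure.map_map measurable_swap (hV.prodMk hU), Measure.prod_swap] at h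
      exact h
    · have h := klDiv_map_le (P.map fun ω => (U ω, V ω)) ((P.map U).prod (P.map V)) measurable_swap
      rw [Measure.map_map measurable_swap (hU.prodMk hV), Measure.prod_swap] at h
      exact h
  rw [hswap, ← compProd_map_condDistrib hU.aemeasurable, ← Measure.compProd_const,
    klDiv_compProd_right_eq_lintegral, lintegral_map (measurable_klDiv_kernel _ _) hV]
  simp

/-- Chain rule for the mutual information, as an inequality: the information gained about `U` from
`W` on top of `V`. The map `e` encodes the pair `(V, U)`, with inverses `v` and `u`. -/
lemma mutualInformation_add_lintegral_klDiv_le [StandardBorelSpace 𝓦] [Nonempty 𝓦]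
    {U : Ω → 𝓤} {V : Ω → 𝓥} {W : Ω → 𝓦} (hU : Measurable U) (hV : Measurable V)
    (hW : Measurable W) {e : 𝓥 × 𝓤 → 𝓢} {v : 𝓢 → 𝓥} {u : 𝓢 → 𝓤} (he : Measurable e)
    (hv : Measurable v) (hu : Measurable u) (hve : ∀ p, v (e p) = p.1) (hue : ∀ p, u (e p) = p.2) :
    mutualInformation U V P
        + ∫⁻ ω, klDiv (condDistrib W (fun ω' => e (V ω', U ω')) P (e (V ω, U ω)))
            (condDistrib W V P (V ω)) ∂P
      ≤ mutualInformation U (fun ω => (V ω, W ω)) P := by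
  -- `condDistrib` depends on how the conditioning tuple is nested; the encoding `e` lets the lemma
  -- match any nesting.
  set S : Ω → 𝓢 := fun ω => e (V ω, U ω) with hS
  have hSm : Measurable S := by fun_prop
  set κ := condDistrib W S P
  set η := (condDistrib W V P).comap v hv with hη
  have hgm : Measurable fun p : 𝓤 × 𝓥 => e (p.2, p.1) := by fun_prop
  have hg'm : Measurable fun p : 𝓤 × 𝓥 × 𝓦 => (e (p.2.1, p.1), p.2.2) := by fun_prop
  -- The product law seen through `e`. Since `(u, v)` undoes `e`, data processing along it gives
  -- `hinfo`.
  set ν := ((P.map U).prod (P.map V)).map fun p => e (p.2, p.1) with hν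
  have hinfo : mutualInformation U V P ≤ klDiv (P.map S) ν := by
    have h := klDiv_map_le (P.map S) ν (hu.prodMk hv)
    rw [Measure.map_map (hu.prodMk hv) hSm, hν, Measure.map_map (hu.prodMk hv) hgm] at h
    simpa [Function.comp_def, hS, hve, hue, mutualInformation] using h
  -- The kernel `η` reads only the `V` part of the code, so under `ν ⊗ₘ η` the pair `(V, W)` has its
  -- true law and is independent of `U`.
  have hright : ν ⊗ₘ η = ((P.map U).prod (P.map fun ω => (V ω, W ω))).map
      fun p => (e (p.2.1, p.1), p.2.2) := by
    ext s hs
    rw [Measure.compProd_apply hs, Measure.map_apply hg'm hs, Measure.prod_apply (hg'm hs), hν,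
      lintegral_map (Kernel.measurable_kernel_prodMk_left hs) hgm,
      lintegral_prod (fun p : 𝓤 × 𝓥 => η (e (p.2, p.1)) (Prod.mk (e (p.2, p.1)) ⁻¹' s))
        ((Kernel.measurable_kernel_prodMk_left hs).comp hgm).aemeasurable]
    refine lintegral_congr fun x => ?_
    rw [← compProd_map_condDistrib hW.aemeasurable,
      Measure.compProd_apply (measurable_prodMk_left (hg'm hs))]
    refine lintegral_congr fun y => ?_
    rw [hη, Kernel.comap_apply, hve]
    rfl
  have hleft : P.map S ⊗ₘ κ = (P.map fun ω => (U ω, V ω, W ω)).map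
      fun p => (e (p.2.1, p.1), p.2.2) := by
    rw [compProd_map_condDistrib hW.aemeasurable, Measure.map_map hg'm (by fun_prop)]
    rfl
  have hcond : klDiv (P.map S ⊗ₘ κ) (P.map S ⊗ₘ η)
      = ∫⁻ ω, klDiv (κ (S ω)) (condDistrib W V P (V ω)) ∂P := by
    rw [klDiv_compProd_right_eq_lintegral, lintegral_map (measurable_klDiv_kernel _ _) hSm]
    simp [hη, hS, hve]
  calc mutualInformation U V P + ∫⁻ ω, klDiv (κ (S ω)) (condDistrib W V P (V ω)) ∂P
      ≤ klDiv (P.map S) ν + klDiv (P.map S ⊗ₘ κ) (P.map S ⊗ₘ η) := by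
        rw [hcond]; gcongr
    _ = klDiv (P.map S ⊗ₘ κ) (ν ⊗ₘ η) := (klDiv_compProd_eq_add _ _ _ _).symm
    _ ≤ mutualInformation U (fun ω => (V ω, W ω)) P := by
        rw [hleft, hright]
        exact klDiv_map_le _ _ hg'm

end MutualInformation

/-! ### The Cauchy-Schwarz inequality -/

lemma ENNReal.rpow_half_rpow_two (x : ℝ≥0∞) : (x ^ (1 / 2 : ℝ)) ^ (2 : ℝ) = x := by
  rw [← ENNReal.rpow_mul]
  norm_num

lemma ENNReal.sum_rpow_half_mul_rpow_half_le {ι : Type*} (s : Finset ι) (a b : ι → ℝ≥0∞) :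
    ∑ i ∈ s, a i ^ (1 / 2 : ℝ) * b i ^ (1 / 2 : ℝ)
      ≤ ((∑ i ∈ s, a i) * ∑ i ∈ s, b i) ^ (1 / 2 : ℝ) := by
  have h := ENNReal.inner_le_Lp_mul_Lq s (fun i => a i ^ (1 / 2 : ℝ)) (fun i => b i ^ (1 / 2 : ℝ))
    Real.HolderConjugate.two_two
  simp only [ENNReal.rpow_half_rpow_two] at h
  rwa [← ENNReal.mul_rpow_of_nonneg _ _ (by norm_num)] at h

lemma lintegral_rpow_half_mul_rpow_half_le {Ω : Type*} [MeasurableSpace Ω] {P : Measure Ω}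
    {f g : Ω → ℝ≥0∞} (hf : AEMeasurable f P) (hg : AEMeasurable g P) :
    ∫⁻ ω, f ω ^ (1 / 2 : ℝ) * g ω ^ (1 / 2 : ℝ) ∂P
      ≤ (∫⁻ ω, f ω ∂P) ^ (1 / 2 : ℝ) * (∫⁻ ω, g ω ∂P) ^ (1 / 2 : ℝ) := by
  have h := ENNReal.lintegral_mul_le_Lp_mul_Lq P Real.HolderConjugate.two_two
    (hf.pow_const (1 / 2 : ℝ)) (hg.pow_const (1 / 2 : ℝ))
  simpa only [Pi.mul_apply, ENNReal.rpow_half_rpow_two] using h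

/-! ### Thompson sampling -/

namespace ContextualBandit

variable {𝒳 𝒜 𝒪 Ω : Type*} [MeasurableSpace 𝒳] [MeasurableSpace 𝒜] [MeasurableSpace 𝒪]
  [MeasurableSpace Ω] {Φ : ContextualBandit 𝒳 𝒜 𝒪} {T : ℕ} {ψ : 𝒳 × 𝒪 → 𝒜}

/-- Attainment makes the value a greatest element, so the real `sSup` is a true supremum and not its
default value. -/
lemma IsOptimalRule.optimalReward_eq (hψ : Φ.IsOptimalRule T ψ) :
    Φ.optimalReward T = Φ.ruleReward T ψ :=
  IsGreatest.csSup_eq ⟨⟨ψ, hψ.1, rfl⟩, by rintro _ ⟨ψ', hψ', rfl⟩; exact hψ.2 ψ' hψ'⟩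

namespace IsThompsonSampling

variable [StandardBorelSpace 𝒪] [Nonempty 𝒪] {P : Measure Ω} [IsProbabilityMeasure P]
  {Θ : Ω → 𝒪} {X : ℕ → Ω → 𝒳} {Θhat : ℕ → Ω → 𝒪} {R Rstar : ℕ → Ω → ℝ}

lemma measurable_tsAction (hTS : Φ.IsThompsonSampling T ψ P Θ X Θhat R Rstar)
    (hψ : Measurable ψ) {t : ℕ} (ht : t < T) : Measurable (tsAction ψ X Θhat t) :=
  hψ.comp ((hTS.measurable_context t ht).prodMk (hTS.measurable_sample t ht))

lemma measurable_tsHistory (hTS : Φ.IsThompsonSampling T ψ P Θ X Θhat R Rstar)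
    (hψ : Measurable ψ) {t : ℕ} (ht : t ≤ T) : Measurable (tsHistory ψ X Θhat R t) :=
  measurable_pi_lambda _ fun s =>
    have hs : (s : ℕ) < T := s.2.trans_le ht
    (hTS.measurable_tsAction hψ hs).prodMk
      ((hTS.measurable_context s hs).prodMk (hTS.measurable_reward s hs))

lemma roundSigma_le (hTS : Φ.IsThompsonSampling T ψ P Θ X Θhat R Rstar)
    (hψ : Measurable ψ) {t : ℕ} (ht : t < T) :
    roundSigma ψ X Θhat R t ≤ ‹MeasurableSpace Ω› :=
  ((hTS.measurable_tsHistory hψ ht.le).prodMk (hTS.measurable_context t ht)).comap_le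

/-- The reward of optimal play in a round has the law of the reward of one round with the rule. -/
lemma map_rewardStar (hTS : Φ.IsThompsonSampling T ψ P Θ X Θhat R Rstar)
    (hψ : Measurable ψ) {t : ℕ} (ht : t < T) : P.map (Rstar t) = Φ.ruleRewardLaw ψ := by
  have hH := hTS.measurable_tsHistory hψ ht.le
  have hX := hTS.measurable_context t ht
  have hΘ := hTS.measurable_param
  have hR := hTS.measurable_rewardStar t ht
  have := Φ.isProbabilityMeasure_context
  have := Φ.isProbabilityMeasure_prior
  have hind : P.map (fun ω => (X t ω, Θ ω)) = Φ.context.prod Φ.prior := by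
    have h : IndepFun (X t) Θ P := (hTS.indepFun_context t ht).comp measurable_id measurable_fst
    rw [(indepFun_iff_map_prod_eq_prod_map_map hX.aemeasurable hΘ.aemeasurable).mp h,
      hTS.map_context t ht, hTS.map_param]
  have hHXΘ : Measurable fun ω => (tsHistory ψ X Θhat R t ω, X t ω, Θ ω) := by fun_prop
  have hg : Measurable fun p : 𝒳 × 𝒪 => (p.1, ψ p, p.2) := by fun_prop
  ext s hs
  rw [← condDistrib_comp_map hHXΘ.aemeasurable hR.aemeasurable,
    Measure.bind_apply hs (Kernel.aemeasurable _), lintegral_map (Kernel.measurable_coe _ hs) hHXΘ,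
    ruleRewardLaw, Measure.bind_apply hs (Kernel.aemeasurable _),
    lintegral_map (Kernel.measurable_coe _ hs) hg, ← hind,
    lintegral_map (f := fun p : 𝒳 × 𝒪 => Φ.reward (p.1, ψ p, p.2) s)
      ((Kernel.measurable_coe _ hs).comp hg) (hX.prodMk hΘ)]
  refine lintegral_congr_ae ?_
  filter_upwards [hTS.rewardStar t ht] with ω hω
  rw [hω]

/-- Integrability is inherited from the admissibility of the rule, through the common law. -/
lemma integrable_rewardStar (hTS : Φ.IsThompsonSampling T ψ P Θ X Θhat R Rstar)
    (hψ : Φ.IsAdmissibleRule ψ) {t : ℕ} (ht : t < T) : Integrable (Rstar t) P := by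
  have h := hψ.2
  rw [← hTS.map_rewardStar hψ.1 ht] at h
  exact (integrable_map_measure measurable_id.aestronglyMeasurable
    (hTS.measurable_rewardStar t ht).aemeasurable).mp h

lemma integral_rewardStar (hTS : Φ.IsThompsonSampling T ψ P Θ X Θhat R Rstar)
    (hψ : Φ.IsAdmissibleRule ψ) {t : ℕ} (ht : t < T) :
    ∫ ω, Rstar t ω ∂P = ∫ r, r ∂(Φ.ruleRewardLaw ψ) := by
  rw [← hTS.map_rewardStar hψ.1 ht]
  exact (integral_map (hTS.measurable_rewardStar t ht).aemeasurable
    measurable_id.aestronglyMeasurable).symm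

/-- The regret is the sum of the expected conditional regrets of the rounds. -/
lemma regret_eq_sum_integral_condExp (hTS : Φ.IsThompsonSampling T ψ P Θ X Θhat R Rstar)
    (hψ : Φ.IsOptimalRule T ψ) :
    Φ.regret T P R = ∑ t ∈ Finset.range T,
      ∫ ω, condExp (roundSigma ψ X Θhat R t) P (fun ω' => Rstar t ω' - R t ω') ω ∂P := by
  rw [regret, hψ.optimalReward_eq, ruleReward, integral_finsetSum _ fun t ht =>
    hTS.integrable_reward t (Finset.mem_range.mp ht), ← Finset.sum_sub_distrib]
  refine Finset.sum_congr rfl fun t ht => ?_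
  replace ht := Finset.mem_range.mp ht
  rw [integral_condExp (hTS.roundSigma_le hψ.1.1 ht),
    integral_sub (hTS.integrable_rewardStar hψ.1 ht) (hTS.integrable_reward t ht),
    hTS.integral_rewardStar hψ.1 ht]

/-- One round of the chain rule for the information that the history carries on the parameter. -/
lemma mutualInformation_tsHistory_succ_le
    (hTS : Φ.IsThompsonSampling T ψ P Θ X Θhat R Rstar) (hψ : Measurable ψ) {t : ℕ} (ht : t < T) :
    mutualInformation Θ (tsHistory ψ X Θhat R t) P
        + ∫⁻ ω, disintegratedInformation ψ P Θ X Θhat R t ω ∂P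
      ≤ mutualInformation Θ (tsHistory ψ X Θhat R (t + 1)) P := by
  have hH := hTS.measurable_tsHistory hψ ht.le
  have hH' := hTS.measurable_tsHistory hψ (Nat.succ_le_of_lt ht)
  have hX := hTS.measurable_context t ht
  have hA := hTS.measurable_tsAction hψ ht
  have hΘ := hTS.measurable_param
  have hR := hTS.measurable_reward t ht
  -- The context and the action enter before the reward: they cannot decrease the information, and
  -- the chain rule is then applied to `R t` given `V`.
  set V : Ω → (Fin t → 𝒜 × 𝒳 × ℝ) × 𝒳 × 𝒜 :=
    fun ω => (tsHistory ψ X Θhat R t ω, X t ω, tsAction ψ X Θhat t ω) with hV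
  have hVm : Measurable V := by fun_prop
  have hdrop : mutualInformation Θ (tsHistory ψ X Θhat R t) P ≤ mutualInformation Θ V P :=
    mutualInformation_comp_right_le hΘ hVm measurable_fst
  have hchain := mutualInformation_add_lintegral_klDiv_le (P := P) hΘ hVm hR
    (𝓢 := (Fin t → 𝒜 × 𝒳 × ℝ) × 𝒳 × 𝒜 × 𝒪)
    (e := fun p => (p.1.1, p.1.2.1, p.1.2.2, p.2)) (v := fun s => (s.1, s.2.1, s.2.2.1))
    (u := fun s => s.2.2.2) (by fun_prop) (by fun_prop) (by fun_prop) (fun _ => rfl) fun _ => rfl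
  have hsucc : mutualInformation Θ (fun ω => (V ω, R t ω)) P
      ≤ mutualInformation Θ (tsHistory ψ X Θhat R (t + 1)) P :=
    mutualInformation_comp_right_le hΘ hH'
      (f := fun h : Fin (t + 1) → 𝒜 × 𝒳 × ℝ =>
        (((fun s : Fin t => h s.castSucc), (h (Fin.last t)).2.1, (h (Fin.last t)).1),
          (h (Fin.last t)).2.2)) (by fun_prop)
  refine le_trans (add_le_add hdrop (le_of_eq ?_)) (hchain.trans hsucc)
  exact lintegral_condLExp (hTS.roundSigma_le hψ ht) P _

lemma sum_lintegral_disintegratedInformation_le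
    (hTS : Φ.IsThompsonSampling T ψ P Θ X Θhat R Rstar) (hψ : Measurable ψ) {n : ℕ} (hn : n ≤ T) :
    ∑ t ∈ Finset.range n, ∫⁻ ω, disintegratedInformation ψ P Θ X Θhat R t ω ∂P
      ≤ mutualInformation Θ (tsHistory ψ X Θhat R n) P := by
  induction n with
  | zero => simp
  | succ n ih =>
    rw [Finset.sum_range_succ]
    exact (add_le_add_left (ih (Nat.le_of_succ_le hn)) _).trans
      (hTS.mutualInformation_tsHistory_succ_le hψ hn)

end IsThompsonSampling

variable {P : Measure Ω} [IsProbabilityMeasure P] {Θ : Ω → 𝒪} {X : ℕ → Ω → 𝒳}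
  {Θhat : ℕ → Ω → 𝒪} {R Rstar : ℕ → Ω → ℝ} {t : ℕ}

lemma measurable_disintegratedInformation :
    Measurable (disintegratedInformation ψ P Θ X Θhat R t) :=
  measurable_condLExp' _ _ _

lemma aemeasurable_liftedInformationRatio :
    AEMeasurable (liftedInformationRatio ψ P Θ X Θhat R Rstar t) P :=
  ((integrable_condExp.aestronglyMeasurable.aemeasurable.pow_const 2).ennreal_ofReal).div
    measurable_disintegratedInformation.aemeasurable

/-- Where the information ratio and the information are finite, the conditional regret is bounded
by the geometric mean of the two; this is integrated with the Cauchy-Schwarz inequality. -/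
lemma lintegral_abs_condExp_regret_le
    (hratio : ∫⁻ ω, liftedInformationRatio ψ P Θ X Θhat R Rstar t ω ∂P ≠ ∞)
    (hinfo : ∫⁻ ω, disintegratedInformation ψ P Θ X Θhat R t ω ∂P ≠ ∞) :
    ∫⁻ ω, ENNReal.ofReal
        |condExp (roundSigma ψ X Θhat R t) P (fun ω' => Rstar t ω' - R t ω') ω| ∂P
      ≤ (∫⁻ ω, liftedInformationRatio ψ P Θ X Θhat R Rstar t ω ∂P) ^ (1 / 2 : ℝ)
        * (∫⁻ ω, disintegratedInformation ψ P Θ X Θhat R t ω ∂P) ^ (1 / 2 : ℝ) := by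
  refine le_trans (lintegral_mono_ae ?_) (lintegral_rpow_half_mul_rpow_half_le
    aemeasurable_liftedInformationRatio measurable_disintegratedInformation.aemeasurable)
  -- An infinite `I` must be excluded: the ratio would be `0`, and `0 * ∞ = 0` bounds nothing.
  filter_upwards [ae_lt_top' aemeasurable_liftedInformationRatio hratio,
    ae_lt_top measurable_disintegratedInformation hinfo] with ω hω hω'
  rw [← ENNReal.mul_rpow_of_nonneg _ _ (by norm_num)]
  set D := condExp (roundSigma ψ X Θhat R t) P (fun ω' => Rstar t ω' - R t ω') ω
  set I := disintegratedInformation ψ P Θ X Θhat R t ω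
  have hdef : liftedInformationRatio ψ P Θ X Θhat R Rstar t ω = ENNReal.ofReal (D ^ 2) / I := rfl
  have hmul : ENNReal.ofReal (D ^ 2) / I * I = ENNReal.ofReal (D ^ 2) := by
    -- When `I = 0`, the convention `c / 0 = ∞` and the finite ratio force `D = 0`.
    by_cases hI : I = 0
    · rw [hdef, hI] at hω
      have hD : ENNReal.ofReal (D ^ 2) = 0 := by
        by_contra h
        rw [ENNReal.div_zero h] at hω
        exact hω.ne rfl
      rw [hD, hI, mul_zero]
    · exact ENNReal.div_mul_cancel hI hω'.ne
  rw [hdef, hmul, ENNReal.ofReal_rpow_of_nonneg (sq_nonneg D) (by norm_num),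
    ← Real.sqrt_eq_rpow, Real.sqrt_sq_eq_abs]

end ContextualBandit

theorem theorem1 {𝒳 𝒜 𝒪 Ω : Type*} [MeasurableSpace 𝒳] [MeasurableSpace 𝒜]
    [MeasurableSpace 𝒪] [StandardBorelSpace 𝒪] [Nonempty 𝒪]
    [MeasurableSpace Ω] (P : Measure Ω) [IsProbabilityMeasure P]
    (Φ : ContextualBandit 𝒳 𝒜 𝒪) (T : ℕ)
    (ψ : 𝒳 × 𝒪 → 𝒜) (hψ : Φ.IsOptimalRule T ψ)
    (Θ : Ω → 𝒪) (X : ℕ → Ω → 𝒳) (Θhat : ℕ → Ω → 𝒪) (R Rstar : ℕ → Ω → ℝ)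
    (hTS : Φ.IsThompsonSampling T ψ P Θ X Θhat R Rstar)
    (Γ : ℝ) (hΓ : 0 < Γ)
    (hratio : (∑ t ∈ Finset.range T,
        ∫⁻ ω, ContextualBandit.liftedInformationRatio ψ P Θ X Θhat R Rstar t ω ∂P) / (T : ℝ≥0∞)
      ≤ ENNReal.ofReal Γ) :
    ((Φ.regret T P R : ℝ) : EReal) ≤
        (((ENNReal.ofReal Γ * (T : ℝ≥0∞) *
          mutualInformation Θ (ContextualBandit.tsHistory ψ X Θhat R T) P) ^ (1 / 2 : ℝ) :
            ℝ≥0∞) : EReal) ∧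
      mutualInformation Θ (ContextualBandit.tsHistory ψ X Θhat R T) P =
        ∫⁻ ω, klDiv
          (condDistrib Θ (ContextualBandit.tsHistory ψ X Θhat R T) P
            (ContextualBandit.tsHistory ψ X Θhat R T ω)) (P.map Θ) ∂P := by
  refine ⟨?_, mutualInformation_eq_lintegral_klDiv_condDistrib hTS.measurable_param
    (hTS.measurable_tsHistory hψ.1.1 le_rfl)⟩
  -- `ENNReal.ofReal` truncates at `0`, so it dominates the regret and a bound in `ℝ≥0∞` suffices.
  suffices h : ENNReal.ofReal (Φ.regret T P R) ≤ (ENNReal.ofReal Γ * (T : ℝ≥0∞) *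
      mutualInformation Θ (ContextualBandit.tsHistory ψ X Θhat R T) P) ^ (1 / 2 : ℝ) by
    refine le_trans ?_ (EReal.coe_ennreal_le_coe_ennreal_iff.mpr h)
    rw [EReal.coe_ennreal_ofReal]
    exact_mod_cast le_max_left _ _
  rw [hTS.regret_eq_sum_integral_condExp hψ]
  rcases Nat.eq_zero_or_pos T with rfl | hT
  · simp
  have hT0 : (T : ℝ≥0∞) ≠ 0 := by exact_mod_cast hT.ne'
  rw [ENNReal.div_le_iff hT0 (ENNReal.natCast_ne_top T)] at hratio
  have hsum := hTS.sum_lintegral_disintegratedInformation_le hψ.1.1 le_rfl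
  by_cases hinf : mutualInformation Θ (ContextualBandit.tsHistory ψ X Θhat R T) P = ∞
  · have hpos : ENNReal.ofReal Γ * (T : ℝ≥0∞) ≠ 0 := by simp [hΓ, hT.ne']
    rw [hinf, ENNReal.mul_top hpos, ENNReal.top_rpow_of_pos (by norm_num)]
    exact le_top
  have hratio_fin := ENNReal.sum_ne_top.mp (ne_top_of_le_ne_top
    (ENNReal.mul_ne_top ENNReal.ofReal_ne_top (ENNReal.natCast_ne_top T)) hratio)
  have hinfo_fin := ENNReal.sum_ne_top.mp (ne_top_of_le_ne_top hinf hsum)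
  -- The right side is shrunk to `√(∑ E[Γ_t] · ∑ E[I_t])`, then by Cauchy-Schwarz to `∑ √E[Γ_t]
  -- √E[I_t]`, which is compared with the regret round by round.
  refine le_trans ?_ (ENNReal.rpow_le_rpow (mul_le_mul' hratio hsum) (by norm_num))
  refine le_trans ?_ (ENNReal.sum_rpow_half_mul_rpow_half_le _ _ _)
  refine le_trans (ENNReal.ofReal_le_ofReal (Finset.sum_le_sum fun t _ =>
    (le_abs_self _).trans (abs_integral_le_integral_abs))) ?_
  rw [ENNReal.ofReal_sum_of_nonneg fun t _ => integral_nonneg fun ω => abs_nonneg _]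
  refine Finset.sum_le_sum fun t ht => ?_
  rw [ofReal_integral_eq_lintegral_ofReal integrable_condExp.abs
    (Filter.Eventually.of_forall fun ω => abs_nonneg _)]
  exact ContextualBandit.lintegral_abs_condExp_regret_le (hratio_fin t ht) (hinfo_fin t ht)
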